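/- Let $m\ge 1$, $n\ge 0$, let $X\subset\mathbb{R}^n$ be a finite set (e.g. $X\subseteq\{0,1\}^n$), and let $c_1,\dots,c_m\in\mathbb{R}^{n+1}=\mathbb{R}\times\mathbb{R}^n$. Let $\xi=(\xi_1,\dots,\xi_m)$ be a random vector in $\mathbb{R}^{m(n+1)}$ that is continuously distributed, i.e. its law is absolutely continuous with respect to Lebesgue measure (its support is then automatically full-dimensional). Write $c_i+\xi_i=(\tilde c_i,\bar c_i)\in\mathbb{R}\times\mathbb{R}^n$ for the perturbed scenarios and put $$f(x)=\max_{1\le i\le m}\bigl(\bar c_i^\top x+\tilde c_i\bigr),\qquad x\in\mathbb{R}^n .$$ For $S\subseteq\mathbb{R}^n$ and $x\in S$ let $\mathcal N_S(x)=\{g\mid g^\top(y-x)\le 0\ \ \forall y\in S\}$ be the normal cone, and let $\partial f(x)=\{g\mid f(y)\ge f(x)+g^\top(y-x)\ \ \forall y\in\mathbb{R}^n\}$ be the subdifferential. For a finite set $V\subset\mathbb{R}^n$, the oracle SIM-O returns some $\alpha\in\mathbb{R}^V_{\ge 0}$ with $\sum_{v\in V}\alpha_v=1$, the point $x=\sum_{v\in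 V}\alpha_v v$, and some $c\in\partial f(x)\cap(-\mathcal N_{\mathrm{conv}(V)}(x))$ (so that $x$ minimizes $f$ over $\mathrm{conv}(V)$). For $c\in\mathbb{R}^n$, the oracle LIN-O returns some minimizer of $c^\top x$ over $x\in X$. Algorithm SD starts with $V^1=\{\hat x^0\}$, where $\hat x^0\in X$ is returned by LIN-O for an arbitrary objective. In iteration $k=1,2,\dots$ it obtains $(\alpha^k,x^k,c^k)$ from SIM-O for $V^k$ and $\hat x^k$ from LIN-O for $c^k$; it stops if $(c^k)^\top\hat x^k\ge (c^k)^\top x^k$, and otherwise sets $V^{k+1}=V^k\cup\{\hat x^k\}$ and continues. Then, with probability one, the following holds for every run of Algorithm SD on $X$ and $f$ (i.e. for all possible choices made by the two oracles) and every iteration $k$ that is reached: for every minimizer $x^k$ of $f$ over $\mathrm{conv}(V^k)$, the set $\partial f(x^k)\cap(-\mathcal N_{\mathrm{conv}(V^k)}(x^k))$ contains exactly one point. Moreover, there is exactly one vector $c^k$ that SIM-O can return as the subgradient for $V^k$. -/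

import Mathlib

open MeasureTheory
open scoped Pointwise

namespace SimplicialDecomposition

/-- A scenario is a pair `(c₀, c)`: the uncertain constant and the coefficient vector. -/
abbrev Scenario (n : ℕ) : Type := ℝ × EuclideanSpace ℝ (Fin n)

/-- The worst-case objective `f(x) = max_i (cᵢᵀ x + cᵢ₀)` over finitely many scenarios
(a genuine maximum when `0 < m`). -/
noncomputable def worstCase {m n : ℕ} (U : Fin m → Scenario n)
    (x : EuclideanSpace ℝ (Fin n)) : ℝ :=
  ⨆ i, (inner ℝ (U i).2 x + (U i).1)

/-- The subdifferential of `f` at `x`, in the sense of convex analysis. -/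
def subdifferential {n : ℕ} (f : EuclideanSpace ℝ (Fin n) → ℝ)
    (x : EuclideanSpace ℝ (Fin n)) : Set (EuclideanSpace ℝ (Fin n)) :=
  {g | ∀ y, f x + inner ℝ g (y - x) ≤ f y}

/-- The normal cone of `S` at a point `x` of `S`. -/
def normalCone {n : ℕ} (S : Set (EuclideanSpace ℝ (Fin n)))
    (x : EuclideanSpace ℝ (Fin n)) : Set (EuclideanSpace ℝ (Fin n)) :=
  {g | ∀ y ∈ S, inner ℝ g (y - x) ≤ 0}

/-- `(α, x, c)` is a possible output of the oracle SIM-O for the finite set `V`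
(only the values of `α` on `V` matter). -/
structure IsSimOOutput {n : ℕ} (f : EuclideanSpace ℝ (Fin n) → ℝ)
    (V : Finset (EuclideanSpace ℝ (Fin n))) (α : EuclideanSpace ℝ (Fin n) → ℝ)
    (x c : EuclideanSpace ℝ (Fin n)) : Prop where
  nonneg : ∀ v ∈ V, 0 ≤ α v
  sum_eq_one : ∑ v ∈ V, α v = 1
  combination : x = ∑ v ∈ V, α v • v
  subgradient : c ∈ subdifferential f x ∩ -normalCone (convexHull ℝ (V : Set _)) x

/-- `y` is a possible output of the oracle LIN-O for the objective `c`: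
a minimizer of `cᵀ x` over `x ∈ X`. -/
def IsLinOOutput {n : ℕ} (X : Finset (EuclideanSpace ℝ (Fin n)))
    (c y : EuclideanSpace ℝ (Fin n)) : Prop :=
  y ∈ X ∧ ∀ x ∈ X, inner ℝ c y ≤ inner ℝ c x

open scoped Classical in
/-- `Reaches X f k V`: some run of the algorithm SD on the feasible set `X` and the objective `f`
(for some choice of the outputs of both oracles) enters iteration `k`, with `V` as the current
vertex set `Vᵏ`. -/
inductive Reaches {n : ℕ} (X : Finset (EuclideanSpace ℝ (Fin n)))
    (f : EuclideanSpace ℝ (Fin n) → ℝ) : ℕ → Finset (EuclideanSpace ℝ (Fin n)) → Prop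
  | init (d y : EuclideanSpace ℝ (Fin n)) (hy : IsLinOOutput X d y) : Reaches X f 1 {y}
  | step (k : ℕ) (V : Finset (EuclideanSpace ℝ (Fin n)))
      (α : EuclideanSpace ℝ (Fin n) → ℝ) (x c y : EuclideanSpace ℝ (Fin n))
      (hV : Reaches X f k V) (hsim : IsSimOOutput f V α x c) (hlin : IsLinOOutput X c y)
      (hcont : inner ℝ c y < inner ℝ c x) : Reaches X f (k + 1) (insert y V)

end SimplicialDecomposition

/-! Put `C = conv V` and `φ(d) = min_{y ∈ C} f(y + d)`, a convex function of `d`. For any minimizer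
`x` of `f` over `C`, the set `∂f(x) ∩ -N_C(x)` is exactly the subdifferential of `φ` at `0`. This
does not depend on `x`, and it is a single point once `φ` is differentiable at `0`
(`subdifferential_inter_neg_normalCone_eq`).

Translating by `d` only adds `⟪cᵢ, d⟫` to the `i`-th constant, so `φ` is the optimal value, as a
function of the scenarios, composed with an affine map. That value is Lipschitz in the scenarios,
hence differentiable almost everywhere by Rademacher's theorem. Only finitely many `V ⊆ X` occur,
and absolute continuity makes the exceptional scenarios an event of probability zero. -/

open SimplicialDecomposition

local notation "⟪" x ", " y "⟫" => inner ℝ x y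

section InfimalTranslate

variable {n : ℕ}

/-- The infimum over `C` of the translate of `f` by `d`, i.e. the infimal convolution of `f` with
the indicator function of `-C`. -/
noncomputable def infTranslate (f : EuclideanSpace ℝ (Fin n) → ℝ)
    (C : Set (EuclideanSpace ℝ (Fin n))) (d : EuclideanSpace ℝ (Fin n)) : ℝ :=
  ⨅ y : C, f (y + d)

variable {f : EuclideanSpace ℝ (Fin n) → ℝ} {C : Set (EuclideanSpace ℝ (Fin n))}

theorem infTranslate_le (hf : Continuous f) (hC : IsCompact C) {y : EuclideanSpace ℝ (Fin n)}
    (hy : y ∈ C) (d : EuclideanSpace ℝ (Fin n)) : infTranslate f C d ≤ f (y + d) := by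
  have hbdd : BddBelow (Set.range fun y : C => f (y + d)) := by
    have := (hC.image (hf.comp (continuous_add_const d))).bddBelow
    rwa [Set.image_eq_range] at this
  exact ciInf_le hbdd ⟨y, hy⟩

theorem le_infTranslate (hne : C.Nonempty) {d : EuclideanSpace ℝ (Fin n)} {r : ℝ}
    (h : ∀ y ∈ C, r ≤ f (y + d)) : r ≤ infTranslate f C d :=
  haveI := hne.to_subtype
  le_ciInf fun y => h y y.2

theorem exists_infTranslate_eq (hf : Continuous f) (hC : IsCompact C) (hne : C.Nonempty)
    (d : EuclideanSpace ℝ (Fin n)) : ∃ y ∈ C, infTranslate f C d = f (y + d) := by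
  obtain ⟨y, hy, hmin⟩ :=
    hC.exists_isMinOn hne (hf.comp (continuous_add_const d)).continuousOn
  exact ⟨y, hy, le_antisymm (infTranslate_le hf hC hy d) (le_infTranslate hne fun z hz => hmin hz)⟩

theorem infTranslate_zero_eq (hf : Continuous f) (hC : IsCompact C)
    {x : EuclideanSpace ℝ (Fin n)} (hx : x ∈ C) (hmin : IsMinOn f C x) :
    infTranslate f C 0 = f x := by
  refine le_antisymm (by simpa using infTranslate_le hf hC hx 0) (le_infTranslate ⟨x, hx⟩ ?_)
  intro y hy
  simpa using hmin hy

/-- A convex combination of minimizers for `d` and `e` stays in `C` and is a competitor for the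
combined translation. -/
theorem convexOn_infTranslate (hf : Continuous f) (hconv : ConvexOn ℝ Set.univ f)
    (hC : IsCompact C) (hCconv : Convex ℝ C) (hne : C.Nonempty) :
    ConvexOn ℝ Set.univ (infTranslate f C) := by
  refine ⟨convex_univ, fun d _ e _ a b ha hb hab => ?_⟩
  obtain ⟨y, hy, hyd⟩ := exists_infTranslate_eq hf hC hne d
  obtain ⟨z, hz, hze⟩ := exists_infTranslate_eq hf hC hne e
  rw [hyd, hze]
  refine (infTranslate_le hf hC (hCconv hy hz ha hb hab) _).trans ?_
  have := hconv.2 (Set.mem_univ (y + d)) (Set.mem_univ (z + e)) ha hb hab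
  convert this using 2
  simp only [smul_add]
  abel

/-- A convex function lies above its linearization at the origin. -/
theorem ConvexOn.add_inner_le_of_hasFDerivAt {ψ : EuclideanSpace ℝ (Fin n) → ℝ}
    (hψ : ConvexOn ℝ Set.univ ψ) {g : EuclideanSpace ℝ (Fin n)}
    (hg : HasFDerivAt ψ (innerSL ℝ g) 0) (d : EuclideanSpace ℝ (Fin n)) :
    ψ 0 + ⟪g, d⟫ ≤ ψ d := by
  have hline : HasDerivAt (fun t : ℝ => t • d) d 0 := by
    simpa using (hasDerivAt_id (0 : ℝ)).smul_const d
  have hg' : HasFDerivAt ψ (innerSL ℝ g) ((0 : ℝ) • d) := by simpa using hg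
  have hderiv : HasDerivAt (fun t : ℝ => ψ (t • d)) ⟪g, d⟫ 0 :=
    HasFDerivAt.comp_hasDerivAt (l := ψ) (f := fun t : ℝ => t • d) 0 hg' hline
  have hconv : ConvexOn ℝ Set.univ (fun t : ℝ => ψ (t • d)) :=
    hψ.comp_linearMap (LinearMap.toSpanSingleton ℝ _ d)
  have := hconv.le_slope_of_hasDerivAt (Set.mem_univ 0) (Set.mem_univ 1) one_pos hderiv
  simp only [slope_def_field, one_smul, zero_smul, sub_zero, div_one] at this
  linarith

theorem neg_mem_normalCone_iff {x g : EuclideanSpace ℝ (Fin n)} :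
    g ∈ -normalCone C x ↔ ∀ y ∈ C, 0 ≤ ⟪g, y - x⟫ := by
  simp [normalCone]

theorem isMinOn_of_mem_subdifferential {x g : EuclideanSpace ℝ (Fin n)}
    (hg : g ∈ subdifferential f x ∩ -normalCone C x) : IsMinOn f C x := fun y hy =>
  (le_add_of_nonneg_right (neg_mem_normalCone_iff.1 hg.2 y hy)).trans (hg.1 y)

/-- Where the value of the translated problem is differentiable, its gradient is the only
subgradient certifying the optimality of a minimizer. -/
theorem subdifferential_inter_neg_normalCone_eq (hf : Continuous f)
    (hconv : ConvexOn ℝ Set.univ f) (hC : IsCompact C) (hCconv : Convex ℝ C)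
    {g : EuclideanSpace ℝ (Fin n)} (hg : HasFDerivAt (infTranslate f C) (innerSL ℝ g) 0)
    {x : EuclideanSpace ℝ (Fin n)} (hx : x ∈ C) (hmin : IsMinOn f C x) :
    subdifferential f x ∩ -normalCone C x = {g} := by
  have hzero := infTranslate_zero_eq hf hC hx hmin
  ext g'
  rw [Set.mem_singleton_iff]
  constructor
  · rintro ⟨hsub, hnor⟩
    -- `g'` is a subgradient of `φ` at `0`: in the subgradient inequality at `y + d`, the term `⟪g',
    -- y - x⟫` is nonnegative and can be dropped.
    have hle : ∀ d, infTranslate f C 0 + ⟪g', d⟫ ≤ infTranslate f C d := fun d =>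
      le_infTranslate ⟨x, hx⟩ fun y hy => by
        have h1 := hsub (y + d)
        have h2 := neg_mem_normalCone_iff.1 hnor y hy
        rw [show y + d - x = (y - x) + d by abel, inner_add_right] at h1
        linarith
    have hlocal : IsLocalMin (fun d => infTranslate f C d - innerSL ℝ g' d) 0 := by
      refine Filter.Eventually.of_forall fun d => ?_
      have := hle d
      simp only [innerSL_apply_apply, inner_zero_right]
      linarith
    have hz := hlocal.hasFDerivAt_eq_zero (hg.sub (innerSL ℝ g').hasFDerivAt)
    refine ext_inner_right ℝ fun v => ?_
    have := DFunLike.congr_fun hz v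
    simp only [sub_apply, innerSL_apply_apply, zero_apply] at this
    linarith
  · rintro rfl
    have hle := (convexOn_infTranslate hf hconv hC hCconv ⟨x, hx⟩).add_inner_le_of_hasFDerivAt hg
    -- The test translations are `z - x`, which carries `x` to `z`, and `x - y`, which carries `y`
    -- to the minimizer `x`.
    refine ⟨fun z => ?_, neg_mem_normalCone_iff.2 fun y hy => ?_⟩
    · have h1 := hle (z - x)
      have h2 := infTranslate_le hf hC hx (z - x)
      rw [add_sub_cancel] at h2
      linarith
    · have h1 := hle (x - y)
      have h2 := infTranslate_le hf hC hy (x - y)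
      rw [add_sub_cancel] at h2
      rw [← neg_sub, inner_neg_right]
      linarith

end InfimalTranslate

section WorstCase

variable {m n : ℕ}

theorem le_worstCase (U : Fin m → Scenario n) (x : EuclideanSpace ℝ (Fin n)) (i : Fin m) :
    ⟪(U i).2, x⟫ + (U i).1 ≤ worstCase U x :=
  le_ciSup (f := fun i => ⟪(U i).2, x⟫ + (U i).1) (Set.finite_range _).bddAbove i

theorem worstCase_le (hm : 0 < m) {U : Fin m → Scenario n} {x : EuclideanSpace ℝ (Fin n)} {r : ℝ}
    (h : ∀ i, ⟪(U i).2, x⟫ + (U i).1 ≤ r) : worstCase U x ≤ r :=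
  haveI : Nonempty (Fin m) := ⟨⟨0, hm⟩⟩
  ciSup_le h

theorem convexOn_worstCase (hm : 0 < m) (U : Fin m → Scenario n) :
    ConvexOn ℝ Set.univ (worstCase U) := by
  refine ⟨convex_univ, fun x _ y _ a b ha hb hab => worstCase_le hm fun i => ?_⟩
  have h1 := mul_le_mul_of_nonneg_left (le_worstCase U x i) ha
  have h2 := mul_le_mul_of_nonneg_left (le_worstCase U y i) hb
  simp only [inner_add_right, inner_smul_right, smul_eq_mul]
  have h3 : (U i).1 = a * (U i).1 + b * (U i).1 := by rw [← add_mul, hab, one_mul]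
  linarith

theorem continuous_worstCase (hm : 0 < m) (U : Fin m → Scenario n) :
    Continuous (worstCase U) :=
  continuousOn_univ.1 ((convexOn_worstCase hm U).continuousOn isOpen_univ)

/-- Each affine piece changes by at most `R * dist U U'` through its slope and `dist U U'` through
its constant. -/
theorem worstCase_le_add (hm : 0 < m) (U U' : Fin m → Scenario n)
    {x : EuclideanSpace ℝ (Fin n)} {R : ℝ} (hx : ‖x‖ ≤ R) :
    worstCase U x ≤ worstCase U' x + (R + 1) * dist U U' := by
  refine worstCase_le hm fun i => ?_
  have h1 := le_worstCase U' x i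
  have hi : ‖U i - U' i‖ ≤ dist U U' := by
    rw [← dist_eq_norm]
    exact dist_le_pi_dist U U' i
  have h2 : (U i).1 - (U' i).1 ≤ dist U U' :=
    (le_abs_self _).trans ((norm_fst_le (U i - U' i)).trans hi)
  have h3 : ⟪(U i).2 - (U' i).2, x⟫ ≤ dist U U' * R :=
    (real_inner_le_norm _ _).trans <|
      mul_le_mul ((norm_snd_le (U i - U' i)).trans hi) hx (norm_nonneg _) dist_nonneg
  rw [inner_sub_left] at h3
  linarith

theorem exists_lipschitzWith_infTranslate_worstCase (hm : 0 < m)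
    {C : Set (EuclideanSpace ℝ (Fin n))} (hC : IsCompact C) (hne : C.Nonempty) :
    ∃ K, LipschitzWith K fun U : Fin m → Scenario n => infTranslate (worstCase U) C 0 := by
  obtain ⟨R, hR⟩ := hC.isBounded.exists_norm_le
  refine ⟨(R + 1).toNNReal, LipschitzWith.of_le_add_mul' _ fun U U' => ?_⟩
  obtain ⟨y, hy, hyU⟩ := exists_infTranslate_eq (continuous_worstCase hm U') hC hne 0
  refine (infTranslate_le (continuous_worstCase hm U) hC hy 0).trans ?_
  rw [hyU, add_zero]
  exact worstCase_le_add hm U U' (hR y hy)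

/-- Translating the argument of the worst-case objective amounts to changing the constants. -/
theorem worstCase_add_right (U : Fin m → Scenario n) (x d : EuclideanSpace ℝ (Fin n)) :
    worstCase U (x + d) = worstCase (fun i => U i + (⟪(U i).2, d⟫, 0)) x := by
  simp only [worstCase, inner_add_right, Prod.snd_add, Prod.fst_add, add_zero]
  congr 1
  ext i
  ring

theorem exists_hasFDerivAt_infTranslate_worstCase {U : Fin m → Scenario n}
    {C : Set (EuclideanSpace ℝ (Fin n))}
    (h : DifferentiableAt ℝ (fun U : Fin m → Scenario n => infTranslate (worstCase U) C 0) U) :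
    ∃ g, HasFDerivAt (infTranslate (worstCase U) C) (innerSL ℝ g) 0 := by
  -- Rademacher's theorem applied to `φ` itself would say nothing about the particular point `d =
  -- 0`. In scenario space that point corresponds to `U`, which is generic.
  let T : EuclideanSpace ℝ (Fin n) → Fin m → Scenario n := fun d i => U i + (⟪(U i).2, d⟫, 0)
  have hT : DifferentiableAt ℝ T 0 := by
    refine differentiableAt_pi.2 fun i => ?_
    exact (differentiableAt_const _).add
      (((innerSL ℝ (U i).2).differentiableAt).prodMk (differentiableAt_const _))
  have hT0 : T 0 = U := by
    funext i
    simp [T, Prod.ext_iff]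
  have heq : infTranslate (worstCase U) C =
      (fun U : Fin m → Scenario n => infTranslate (worstCase U) C 0) ∘ T := by
    funext d
    simp only [infTranslate, Function.comp, add_zero, T, worstCase_add_right]
  have hd : DifferentiableAt ℝ (infTranslate (worstCase U) C) 0 := by
    rw [heq]
    exact DifferentiableAt.comp 0 (by rwa [hT0]) hT
  refine ⟨(InnerProductSpace.toDual ℝ _).symm (fderiv ℝ (infTranslate (worstCase U) C) 0),
    hd.hasFDerivAt.congr_fderiv ?_⟩
  ext v
  simp

instance isAddHaarMeasure_volume_scenario :
    (volume : Measure (Scenario n)).IsAddHaarMeasure :=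
  Measure.prod.instIsAddHaarMeasure volume volume

instance isAddHaarMeasure_volume_pi_scenario :
    (volume : Measure (Fin m → Scenario n)).IsAddHaarMeasure :=
  Measure.pi.isAddHaarMeasure _

/-- For almost all scenarios, the value of the problem over `C` is differentiable with respect to
translations. -/
theorem ae_exists_hasFDerivAt_infTranslate_worstCase (hm : 0 < m)
    {C : Set (EuclideanSpace ℝ (Fin n))} (hC : IsCompact C) (hne : C.Nonempty) :
    ∀ᵐ U : Fin m → Scenario n, ∃ g, HasFDerivAt (infTranslate (worstCase U) C) (innerSL ℝ g) 0 := by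
  obtain ⟨K, hK⟩ := exists_lipschitzWith_infTranslate_worstCase hm hC hne
  filter_upwards [hK.ae_differentiableAt] with U hU
  exact exists_hasFDerivAt_infTranslate_worstCase hU

end WorstCase

theorem SimplicialDecomposition.Reaches.subset_and_nonempty {n : ℕ}
    {X : Finset (EuclideanSpace ℝ (Fin n))} {f : EuclideanSpace ℝ (Fin n) → ℝ} {k : ℕ}
    {V : Finset (EuclideanSpace ℝ (Fin n))} (h : Reaches X f k V) : V ⊆ X ∧ V.Nonempty := by
  classical
  induction h with
  | init d y hy => exact ⟨by simpa using hy.1, by simp⟩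
  | step k V α x c y hV hsim hlin hcont ih =>
    refine ⟨fun z hz => ?_, ⟨y, by simp⟩⟩
    rcases Finset.mem_insert.1 hz with rfl | hz
    · exact hlin.1
    · exact ih.1 hz

theorem SimplicialDecomposition.IsSimOOutput.mem_convexHull {n : ℕ}
    {f : EuclideanSpace ℝ (Fin n) → ℝ} {V : Finset (EuclideanSpace ℝ (Fin n))}
    {α : EuclideanSpace ℝ (Fin n) → ℝ} {x c : EuclideanSpace ℝ (Fin n)}
    (h : IsSimOOutput f V α x c) : x ∈ convexHull ℝ (V : Set (EuclideanSpace ℝ (Fin n))) :=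
  Finset.mem_convexHull'.2 ⟨α, h.nonneg, h.sum_eq_one, h.combination.symm⟩

theorem mainTheorem2 {m n : ℕ} (hm : 0 < m)
    (X : Finset (EuclideanSpace ℝ (Fin n)))
    (c : Fin m → SimplicialDecomposition.Scenario n)
    {Ω : Type*} [MeasurableSpace Ω] (P : Measure Ω) [IsProbabilityMeasure P]
    (ξ : Ω → Fin m → SimplicialDecomposition.Scenario n) (hξ : AEMeasurable ξ P)
    (hξ_cont : P.map ξ ≪ (volume : Measure (Fin m → SimplicialDecomposition.Scenario n))) :
    ∀ᵐ ω ∂P, ∀ (k : ℕ) (V : Finset (EuclideanSpace ℝ (Fin n))),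
      SimplicialDecomposition.Reaches X
          (SimplicialDecomposition.worstCase (fun i => c i + ξ ω i)) k V →
        (∀ x ∈ convexHull ℝ (V : Set (EuclideanSpace ℝ (Fin n))),
          IsMinOn (SimplicialDecomposition.worstCase (fun i => c i + ξ ω i))
              (convexHull ℝ (V : Set (EuclideanSpace ℝ (Fin n)))) x →
            ∃ g, SimplicialDecomposition.subdifferential
                  (SimplicialDecomposition.worstCase (fun i => c i + ξ ω i)) x ∩
                -SimplicialDecomposition.normalCone
                  (convexHull ℝ (V : Set (EuclideanSpace ℝ (Fin n)))) x = {g}) ∧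
        (∃! g, ∃ (α : EuclideanSpace ℝ (Fin n) → ℝ) (x : EuclideanSpace ℝ (Fin n)),
          SimplicialDecomposition.IsSimOOutput
            (SimplicialDecomposition.worstCase (fun i => c i + ξ ω i)) V α x g) := by
  have hfin : ∀ᵐ U : Fin m → Scenario n, ∀ V ∈ X.powerset, V.Nonempty →
      ∃ g, HasFDerivAt (infTranslate (worstCase U)
        (convexHull ℝ (V : Set (EuclideanSpace ℝ (Fin n))))) (innerSL ℝ g) 0 := by
    refine (Finset.eventually_all _).2 fun V _ => ?_
    by_cases hV : V.Nonempty
    · filter_upwards [ae_exists_hasFDerivAt_infTranslate_worstCase hm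
        (V.finite_toSet.isCompact_convexHull ℝ) (convexHull_nonempty_iff.2 hV)] with U hU _ using hU
    · exact Filter.Eventually.of_forall fun U h => absurd h hV
  -- Translation by `c` preserves Lebesgue measure, so the null set can be described in terms of the
  -- noise alone.
  have hshift := (measurePreserving_add_left volume c).quasiMeasurePreserving.ae hfin
  filter_upwards [ae_of_ae_map hξ (hξ_cont.ae_le hshift)] with ω hω k V hreach
  obtain ⟨hVX, hVne⟩ := hreach.subset_and_nonempty
  obtain ⟨g, hg⟩ := hω V (Finset.mem_powerset.2 hVX) hVne
  change HasFDerivAt (infTranslate (worstCase fun i => c i + ξ ω i) _) _ 0 at hg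
  have hcont := continuous_worstCase hm fun i => c i + ξ ω i
  have hcpt : IsCompact (convexHull ℝ (V : Set (EuclideanSpace ℝ (Fin n)))) :=
    V.finite_toSet.isCompact_convexHull ℝ
  have key : ∀ x ∈ convexHull ℝ (V : Set (EuclideanSpace ℝ (Fin n))),
      IsMinOn (worstCase fun i => c i + ξ ω i) (convexHull ℝ (V : Set _)) x →
      subdifferential (worstCase fun i => c i + ξ ω i) x ∩
        -normalCone (convexHull ℝ (V : Set _)) x = {g} := fun x hx hmin =>
    subdifferential_inter_neg_normalCone_eq hcont (convexOn_worstCase hm _) hcpt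
      (convex_convexHull ℝ _) hg hx hmin
  refine ⟨fun x hx hmin => ⟨g, key x hx hmin⟩, g, ?_, ?_⟩
  · obtain ⟨x, hx, hmin⟩ :=
      hcpt.exists_isMinOn (convexHull_nonempty_iff.2 hVne) hcont.continuousOn
    obtain ⟨α, hα, hsum, hcomb⟩ := Finset.mem_convexHull'.1 hx
    exact ⟨α, x, hα, hsum, hcomb.symm, (key x hx hmin).symm ▸ Set.mem_singleton g⟩
  -- The returned subgradient itself certifies that `x` is a minimizer, and `g` in `key` is the same
  -- for all minimizers.
  · rintro g' ⟨α, x, hout⟩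
    have hmem := hout.subgradient
    rwa [key x hout.mem_convexHull (isMinOn_of_mem_subdifferential hmem)] at hmem
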